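/- Let $m,n\ge 1$, let $X\in\mathbb{R}^{m\times n}$ and let $\epsilon>0$, $\delta>0$. Write $\|X\|_F=\big(\sum_{i,j}X_{ij}^2\big)^{1/2}$ for the Frobenius norm and $\|A\|_2=\max_{\|y\|_2=1}\|Ay\|_2$ for the spectral norm. Let $\{p_{ij}\}_{i,j=1}^{m,n}$ be a probability distribution on the index pairs, i.e. $p_{ij}\ge 0$ and $\sum_{i,j}p_{ij}=1$, and assume that for some $\beta\in(0,1]$ $$p_{ij}\ \ge\ \frac{\beta}{2}\left(\frac{X_{ij}^2}{\|X\|_F^2}+\frac{|X_{ij}|}{\sum_{k,l=1}^{m,n}|X_{kl}|}\right)\qquad\text{for all } i,j$$ (with the convention $0/0=0$, which matters only for $X=0$). For an integer $s>0$ let $(i_1,j_1),\dots,(i_s,j_s)$ be independent, identically distributed random index pairs with $\mathbb{P}[(i_t,j_t)=(i,j)]=p_{ij}$ for all $t,i,j$, and let $$\mathcal{S}_\Omega(X)=\frac1s\sum_{t=1}^s\frac{X_{i_tj_t}}{p_{i_tj_t}}\,e_{i_t}e_{j_t}^T ,$$ where $e_i$ denotes the $i$-th standard basis vector of the appropriate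 dimension. Suppose that either (i) $\epsilon\le\|X\|_F$ and $\displaystyle s\ \ge\ \frac{6\max\{m,n\}\ln\left((m+n)/\delta\right)}{\beta\epsilon^2}\,\|X\|_F^2$, or (ii) $\epsilon>\|X\|_F$ and $\displaystyle s\ \ge\ \frac{6\max\{m,n\}\ln\left((m+n)/\delta\right)}{\beta\epsilon}\,\|X\|_F$. Then, with probability at least $1-\delta$, $$\|\mathcal{S}_\Omega(X)-X\|_2\le\epsilon .$$ -/

import Mathlib

open MeasureTheory ProbabilityTheory

noncomputable section

/-- The Frobenius norm of a real matrix. -/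
def frobNorm {m n : ℕ} (A : Matrix (Fin m) (Fin n) ℝ) : ℝ :=
  Real.sqrt (∑ i, ∑ j, A i j ^ 2)

/-- The spectral norm of a real matrix: the operator norm of `y ↦ A y` with respect to the
Euclidean norms on both sides. -/
def specNorm {m n : ℕ} (A : Matrix (Fin m) (Fin n) ℝ) : ℝ :=
  ‖(Matrix.toEuclideanLin A).toContinuousLinearMap‖

/-- The numbers `p i j` form a probability distribution on the index pairs. -/
structure IsProbDist {m n : ℕ} (p : Fin m → Fin n → ℝ) : Prop where
  nonneg : ∀ i j, 0 ≤ p i j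
  sum_eq_one : ∑ i, ∑ j, p i j = 1

/-- The random index pairs `idx 0, …, idx (s - 1)` on the probability space `(Ω, P)` are
independent, and each of them is equal to `(i, j)` with probability `p i j`. -/
structure IsIIDSample {m n s : ℕ} {Ω : Type*} [MeasurableSpace Ω] (P : Measure Ω)
    (p : Fin m → Fin n → ℝ) (idx : Fin s → Ω → Fin m × Fin n) : Prop where
  measurable : ∀ t, Measurable (idx t)
  indep : iIndepFun idx P
  law : ∀ t i j, P.real {ω | idx t ω = (i, j)} = p i j

/-- The sampling operator determined by the sampled pairs `idx 0, …, idx (s - 1)`: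
`(1 / s) ∑ₜ (X_{iₜ jₜ} / p_{iₜ jₜ}) e_{iₜ} e_{jₜ}ᵀ`. Repeated pairs count with multiplicity. -/
def samplingOperator {m n s : ℕ} (p : Fin m → Fin n → ℝ) (idx : Fin s → Fin m × Fin n)
    (X : Matrix (Fin m) (Fin n) ℝ) : Matrix (Fin m) (Fin n) ℝ :=
  (1 / (s : ℝ)) • ∑ t, Matrix.single (idx t).1 (idx t).2
    (X (idx t).1 (idx t).2 / p (idx t).1 (idx t).2)

end

/-!
The error `samplingOperator p idx X - X` is `1 / s` times a sum of `s` independent centred random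
matrices `A - X`, where `A` has a single nonzero entry `X i j / p i j`. Passing to symmetric
dilations turns the spectral norm into a largest eigenvalue of a symmetric matrix of size `m + n`,
and the theorem becomes an instance of the matrix Bernstein inequality with the sharp dimensional
factor `m + n`. Write `N = max m n` and `F = frobNorm X`. The quadratic part of the lower bound on
`p` makes all `X i j ^ 2 / p i j` at most `2 * F ^ 2 / β`, so that the variance is at most
`2 * N * F ^ 2 / β` (`posSemidef_variance`). The linear part makes all `|X i j| / p i j` at most
`2 * N * F / β`, so that each summand has norm at most `2 * N * F / β + F` (`posSemidef_range`),
which is at most `3 * N * F / β`.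
The exponent in Bernstein's bound is then `s * ε ^ 2 * β / (2 * N * F * (2 * F + ε))`
(`sum_prod_bad_le`), and replacing `2 * F + ε` by three times the larger of `F` and `ε` gives the
two cases with the constant `6`.

The matrix Bernstein inequality (`matrix_bernstein`) is proved by the Ahlswede–Winter method: the
expected trace of the exponential is bounded one summand at a time, using the Golden–Thompson
inequality `trace_exp_add_le` to split off a factor, and the scalar inequality
`exp x ≤ 1 + x + x ^ 2 / (2 * (1 - u / 3))` for `|x| ≤ u < 3`, transferred to symmetric matrices by
diagonalization. For identically distributed summands this loses nothing against the approach by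
Lieb's concavity theorem, since the norm of the total variance is the sum of the norms.
Golden–Thompson itself follows from the Lie–Trotter formula `tendsto_exp_mul_exp_pow` along powers
of two and the trace inequality `|tr ((A B) ^ (2 ^ k))| ≤ |tr (A ^ (2 ^ k) B ^ (2 ^ k))|` for
symmetric `A` and `B` (`abs_trace_pow_le_and`).

The index pairs take finitely many values, so all expectations are finite sums over the possible
samples, weighted by the product law (`measureReal_le_sum_prod`).
-/

open Filter Topology Matrix NormedSpace

/-! ### The Golden–Thompson inequality -/

section GoldenThompson

variable {ι : Type*} [Fintype ι] [DecidableEq ι]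

/-- The trace is cyclic, hence so are the traces of powers of a product. -/
lemma trace_mul_pow_comm (A B : Matrix ι ι ℝ) (k : ℕ) :
    ((A * B) ^ k).trace = ((B * A) ^ k).trace := by
  cases k with
  | zero => simp
  | succ k =>
    have h : A * (B * A) ^ k = (A * B) ^ k * A :=
      (show SemiconjBy A (B * A) (A * B) by simp [SemiconjBy, mul_assoc]).pow_right k
    rw [pow_succ, ← mul_assoc, ← h, trace_mul_comm, ← mul_assoc, ← pow_succ']

omit [DecidableEq ι] in
/-- The Cauchy–Schwarz inequality for the Hilbert–Schmidt inner product. -/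
lemma trace_mul_sq_le (A B : Matrix ι ι ℝ) :
    (A * B).trace ^ 2 ≤ (A * Aᴴ).trace * (B * Bᴴ).trace := by
  have h := Finset.sum_mul_sq_le_sq_mul_sq (Finset.univ : Finset (ι × ι))
    (fun q => A q.1 q.2) (fun q => B q.2 q.1)
  simp only [Fintype.sum_prod_type] at h
  rw [Finset.sum_comm (f := fun i j => B j i ^ 2)] at h
  simpa [trace, mul_apply, sq] using h

lemma trace_mul_conjTranspose_pow_nonneg (A : Matrix ι ι ℝ) (k : ℕ) :
    0 ≤ ((A * Aᴴ) ^ k).trace :=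
  ((posSemidef_self_mul_conjTranspose A).pow k).trace_nonneg

/-- Two trace inequalities for powers of two, which feed each other in the induction: the first
is Weyl's comparison of `M ^ (2 ^ (k + 1))` with the singular values of `M`, the second is the
Araki–Lieb–Thirring inequality. -/
lemma abs_trace_pow_le_and (k : ℕ) :
    (∀ M : Matrix ι ι ℝ, |(M ^ 2 ^ (k + 1)).trace| ≤ ((M * Mᴴ) ^ 2 ^ k).trace) ∧
    (∀ A B : Matrix ι ι ℝ, A.IsHermitian → B.IsHermitian →
      |((A * B) ^ 2 ^ k).trace| ≤ |(A ^ 2 ^ k * B ^ 2 ^ k).trace|) := by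
  induction k with
  | zero =>
    refine ⟨fun M => ?_, fun A B _ _ => by simp⟩
    have h0 := trace_mul_conjTranspose_pow_nonneg M 1
    have h := trace_mul_sq_le M M
    simp only [zero_add, pow_one, pow_zero] at h0 ⊢
    exact abs_le_of_sq_le_sq (by rw [pow_two M]; linarith [sq (M * Mᴴ).trace]) h0
  | succ k ih =>
    obtain ⟨ih1, ih2⟩ := ih
    refine ⟨fun M => ?_, fun A B hA hB => ?_⟩
    · have h1 := ih1 (M ^ 2)
      rw [← pow_mul, ← pow_succ'] at h1
      have e1 : ((M ^ 2 * (M ^ 2)ᴴ) ^ 2 ^ k).trace = ((M * Mᴴ * (Mᴴ * M)) ^ 2 ^ k).trace := by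
        rw [show M ^ 2 * (M ^ 2)ᴴ = M * (M * Mᴴ * Mᴴ) by
          simp [pow_two, mul_assoc], trace_mul_pow_comm]
        simp [mul_assoc]
      rw [e1] at h1
      refine h1.trans ((le_abs_self _).trans ((ih2 _ _ (isHermitian_mul_conjTranspose_self M)
        (isHermitian_conjTranspose_mul_self M)).trans ?_))
      refine abs_le_of_sq_le_sq ?_ (trace_mul_conjTranspose_pow_nonneg _ _)
      refine (trace_mul_sq_le _ _).trans_eq ?_
      rw [((isHermitian_mul_conjTranspose_self M).pow _).eq,
        ((isHermitian_conjTranspose_mul_self M).pow _).eq, ← pow_add, ← pow_add,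
        trace_mul_pow_comm Mᴴ M, ← sq, pow_succ 2 k, mul_two]
    · have h1 := ih1 (A * B)
      have e1 : A * B * (A * B)ᴴ = A * (B * B * A) := by
        rw [conjTranspose_mul, hA.eq, hB.eq]; simp [mul_assoc]
      rw [e1, trace_mul_pow_comm A (B * B * A),
        show B * B * A * A = B ^ 2 * A ^ 2 by simp [pow_two, mul_assoc]] at h1
      refine h1.trans ((le_abs_self _).trans ((ih2 _ _ (hB.pow 2) (hA.pow 2)).trans_eq ?_))
      rw [← pow_mul, ← pow_mul, ← pow_succ', trace_mul_comm]

/-- Telescoping of a difference of powers; the factor `c ^ k` in place of `c ^ (k - 1)` avoids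
truncated subtraction. -/
lemma norm_pow_sub_pow_le {E : Type*} [NormedRing E] [NormOneClass E] {x y : E} {c : ℝ}
    (hc : 1 ≤ c) (hx : ‖x‖ ≤ c) (hy : ‖y‖ ≤ c) (k : ℕ) :
    ‖x ^ k - y ^ k‖ ≤ k * c ^ k * ‖x - y‖ := by
  have h0 : 0 ≤ c := by linarith
  induction k with
  | zero => simp
  | succ k ih =>
    have e : x ^ (k + 1) - y ^ (k + 1) = x ^ k * (x - y) + (x ^ k - y ^ k) * y := by
      simp only [pow_succ]; noncomm_ring
    have h1 : ‖x ^ k‖ ≤ c ^ (k + 1) :=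
      (norm_pow_le x k).trans ((pow_le_pow_left₀ (norm_nonneg _) hx k).trans
        (pow_le_pow_right₀ hc k.le_succ))
    calc ‖x ^ (k + 1) - y ^ (k + 1)‖ ≤ ‖x ^ k‖ * ‖x - y‖ + ‖x ^ k - y ^ k‖ * ‖y‖ := by
          rw [e]
          exact (norm_add_le _ _).trans (add_le_add (norm_mul_le _ _) (norm_mul_le _ _))
      _ ≤ c ^ (k + 1) * ‖x - y‖ + (k * c ^ k * ‖x - y‖) * c := by gcongr
      _ = (k + 1 : ℕ) * c ^ (k + 1) * ‖x - y‖ := by push_cast; ring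

lemma norm_exp_le_exp_norm {E : Type*} [NormedRing E] [NormOneClass E] [NormedAlgebra ℝ E]
    [CompleteSpace E] (x : E) : ‖exp x‖ ≤ Real.exp ‖x‖ := by
  rw [congrFun (exp_eq_tsum ℝ) x, Real.exp_eq_exp_ℝ]
  refine tsum_of_norm_bounded (exp_series_hasSum_exp' (𝕂 := ℝ) ‖x‖) fun k => ?_
  rw [norm_smul, norm_inv, Real.norm_natCast, smul_eq_mul]
  gcongr
  exact norm_pow_le x k

/-- The **Lie–Trotter product formula**. -/
lemma tendsto_exp_mul_exp_pow {E : Type*} [NormedRing E] [NormOneClass E] [NormedAlgebra ℝ E]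
    [CompleteSpace E] (a b : E) :
    Tendsto (fun k : ℕ => (exp ((k : ℝ)⁻¹ • a) * exp ((k : ℝ)⁻¹ • b)) ^ k) atTop
      (𝓝 (exp (a + b))) := by
  let _ : NormedAlgebra ℚ E := NormedAlgebra.restrictScalars ℚ ℝ E
  have hd : HasDerivAt (fun t : ℝ => exp (t • a) * exp (t • b) - exp (t • (a + b))) 0 0 := by
    have h (c : E) : HasDerivAt (fun t : ℝ => exp (t • c)) c 0 := by
      simpa using hasDerivAt_exp_smul_const (𝕂 := ℝ) c (0 : ℝ)
    have h2 := ((h a).mul (h b)).sub (h (a + b))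
    simp only [zero_smul, exp_zero, mul_one, one_mul, sub_self] at h2
    exact h2
  have hlim : Tendsto (fun k : ℕ => (k : ℝ) *
      ‖exp ((k : ℝ)⁻¹ • a) * exp ((k : ℝ)⁻¹ • b) - exp ((k : ℝ)⁻¹ • (a + b))‖) atTop (𝓝 0) := by
    have h1 := (hasDerivAt_iff_tendsto_slope.1 hd).comp
      (show Tendsto (fun k : ℕ => (k : ℝ)⁻¹) atTop (𝓝[≠] 0) by
        refine tendsto_nhdsWithin_iff.2 ⟨tendsto_inv_atTop_nhds_zero_nat, ?_⟩
        filter_upwards [eventually_gt_atTop 0] with k hk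
        simp [hk.ne'])
    have h2 := h1.norm
    simp only [Function.comp_def, slope, vsub_eq_sub, sub_zero, zero_smul, exp_zero, mul_one,
      sub_self, inv_inv, norm_smul, norm_zero, Real.norm_natCast] at h2
    exact h2
  have hbound (k : ℕ) (hk : 0 < k) :
      ‖(exp ((k : ℝ)⁻¹ • a) * exp ((k : ℝ)⁻¹ • b)) ^ k - exp (a + b)‖ ≤
        Real.exp (‖a‖ + ‖b‖) * ((k : ℝ) *
      ‖exp ((k : ℝ)⁻¹ • a) * exp ((k : ℝ)⁻¹ • b) - exp ((k : ℝ)⁻¹ • (a + b))‖) := by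
    have hk' : (k : ℝ) ≠ 0 := by positivity
    have hn (c : E) : ‖exp ((k : ℝ)⁻¹ • c)‖ ≤ Real.exp ((k : ℝ)⁻¹ * ‖c‖) := by
      refine (norm_exp_le_exp_norm _).trans_eq ?_
      rw [norm_smul, norm_inv, Real.norm_natCast]
    have h := norm_pow_sub_pow_le (c := Real.exp ((k : ℝ)⁻¹ * (‖a‖ + ‖b‖)))
      (x := exp ((k : ℝ)⁻¹ • a) * exp ((k : ℝ)⁻¹ • b)) (y := exp ((k : ℝ)⁻¹ • (a + b)))
      (Real.one_le_exp (by positivity))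
      (by rw [mul_add, Real.exp_add]; exact (norm_mul_le _ _).trans (by gcongr <;> exact hn _))
      ((hn _).trans (by gcongr; exact norm_add_le _ _)) k
    rw [← NormedSpace.exp_nsmul, ← Real.exp_nat_mul, ← mul_assoc (k : ℝ), mul_inv_cancel₀ hk', one_mul,
      ← Nat.cast_smul_eq_nsmul ℝ, smul_smul, mul_inv_cancel₀ hk', one_smul] at h
    linarith
  rw [tendsto_iff_norm_sub_tendsto_zero]
  refine squeeze_zero' (Eventually.of_forall fun _ => norm_nonneg _)
    ((eventually_gt_atTop 0).mono hbound) ?_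
  simpa using hlim.const_mul (Real.exp (‖a‖ + ‖b‖))

/-- The exponential of a real symmetric matrix is positive semidefinite, being the square of the
symmetric matrix `exp (A / 2)`. -/
lemma posSemidef_exp {A : Matrix ι ι ℝ} (hA : A.IsHermitian) : (exp A).PosSemidef := by
  have hB : (exp ((2 : ℝ)⁻¹ • A)).IsHermitian := (hA.smul (.all _)).exp
  have h := posSemidef_self_mul_conjTranspose (exp ((2 : ℝ)⁻¹ • A))
  rwa [hB.eq, ← exp_add_of_commute _ _ (Commute.refl _), ← add_smul,
    show (2 : ℝ)⁻¹ + 2⁻¹ = 1 by norm_num, one_smul] at h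

open scoped MatrixOrder Matrix.Norms.L2Operator in
/-- The trace pairing of positive semidefinite matrices is nonnegative. -/
lemma trace_mul_nonneg {A B : Matrix ι ι ℝ} (hA : A.PosSemidef) (hB : B.PosSemidef) :
    0 ≤ (A * B).trace := by
  obtain ⟨C, rfl⟩ := CStarAlgebra.nonneg_iff_eq_star_mul_self.mp hA.nonneg
  rw [mul_assoc, trace_mul_comm]
  exact (hB.mul_mul_conjTranspose_same C).trace_nonneg

open scoped Matrix.Norms.L2Operator in
/-- The **Golden–Thompson inequality** for real symmetric matrices. -/
lemma trace_exp_add_le {A B : Matrix ι ι ℝ} (hA : A.IsHermitian) (hB : B.IsHermitian) :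
    (exp (A + B)).trace ≤ (exp A * exp B).trace := by
  cases isEmpty_or_nonempty ι
  · simp [trace]
  have hlim := (tendsto_exp_mul_exp_pow A B).comp (tendsto_pow_atTop_atTop_of_one_lt one_lt_two)
  have htr : Continuous (fun M : Matrix ι ι ℝ => M.trace) := by fun_prop
  refine le_of_tendsto ((htr.tendsto _).comp hlim) (Eventually.of_forall fun k => ?_)
  have hherm {C : Matrix ι ι ℝ} (hC : C.IsHermitian) (c : ℝ) : (exp (c • C)).IsHermitian :=
    (hC.smul (.all _)).exp
  have hpow (C : Matrix ι ι ℝ) : exp (((2 ^ k : ℕ) : ℝ)⁻¹ • C) ^ 2 ^ k = exp C := by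
    rw [← Matrix.exp_nsmul, ← Nat.cast_smul_eq_nsmul ℝ, smul_smul, mul_inv_cancel₀ (by positivity),
      one_smul]
  have h := (abs_trace_pow_le_and k).2 _ _ (hherm hA ((2 ^ k : ℕ) : ℝ)⁻¹)
    (hherm hB ((2 ^ k : ℕ) : ℝ)⁻¹)
  rw [hpow, hpow, abs_of_nonneg (trace_mul_nonneg (posSemidef_exp hA) (posSemidef_exp hB))] at h
  exact (le_abs_self _).trans h

end GoldenThompson

/-! ### The matrix Bernstein inequality for a finitely supported law -/

section Bernstein

variable {ι : Type*} [Fintype ι] [DecidableEq ι]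

/-- The scalar Bernstein estimate, from `(k + 2)! ≥ 2 * 3 ^ k`. -/
lemma exp_le_one_add_add_sq {x u : ℝ} (hx : |x| ≤ u) (hu : u < 3) :
    Real.exp x ≤ 1 + x + (2 * (1 - u / 3))⁻¹ * x ^ 2 := by
  have hu0 : 0 ≤ u := (abs_nonneg x).trans hx
  have h1 : HasSum (fun k : ℕ => x ^ k / k.factorial) (Real.exp x) := by
    rw [Real.exp_eq_exp_ℝ]; exact expSeries_div_hasSum_exp x
  have h2 := (hasSum_nat_add_iff' 2).2 h1
  have h3 : HasSum (fun k : ℕ => x ^ 2 / 2 * (u / 3) ^ k) (x ^ 2 / 2 * (1 - u / 3)⁻¹) :=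
    (hasSum_geometric_of_lt_one (by positivity) (by linarith)).mul_left _
  have hfac (k : ℕ) : (2 * 3 ^ k : ℝ) ≤ ((k + 2).factorial : ℝ) := by
    exact_mod_cast (by simpa [add_comm] using Nat.factorial_mul_pow_le_factorial (m := 2) (n := k))
  have h4 := hasSum_le (fun k => ?_) h2 h3
  · simp only [Finset.sum_range_succ, Finset.sum_range_zero, pow_zero, pow_one, Nat.factorial,
      Nat.cast_one, div_one, zero_add, mul_one] at h4
    rw [mul_inv]
    linarith
  · calc x ^ (k + 2) / ((k + 2).factorial : ℝ) ≤ |x| ^ (k + 2) / ((k + 2).factorial : ℝ) := by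
          rw [← abs_pow]
          gcongr
          exact le_abs_self _
      _ ≤ |x| ^ (k + 2) / (2 * 3 ^ k) := by gcongr; exact hfac k
      _ = x ^ 2 / 2 * (|x| / 3) ^ k := by rw [pow_add, sq_abs, div_pow]; field_simp
      _ ≤ x ^ 2 / 2 * (u / 3) ^ k := by gcongr

lemma exists_eq_conj_diagonal {A : Matrix ι ι ℝ} (hA : A.IsHermitian) :
    ∃ (U : Matrix ι ι ℝ) (d : ι → ℝ), U * Uᴴ = 1 ∧ Uᴴ * U = 1 ∧ A = U * diagonal d * Uᴴ := by
  refine ⟨hA.eigenvectorUnitary, hA.eigenvalues, ?_, ?_, ?_⟩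
  · exact Unitary.coe_mul_star_self hA.eigenvectorUnitary
  · exact Unitary.coe_star_mul_self hA.eigenvectorUnitary
  · have h := hA.spectral_theorem
    rw [Unitary.conjStarAlgAut_apply] at h
    exact h

lemma exp_conj_diagonal {U : Matrix ι ι ℝ} (hU : U * Uᴴ = 1) (d : ι → ℝ) :
    exp (U * diagonal d * Uᴴ) = U * diagonal (fun i => Real.exp (d i)) * Uᴴ := by
  have hinv : U⁻¹ = Uᴴ := inv_eq_right_inv hU
  rw [← hinv, exp_conj _ _ (IsUnit.of_mul_eq_one _ hU), exp_diagonal]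
  congr 3
  funext i
  rw [Pi.coe_exp, Real.exp_eq_exp_ℝ]

/-- A symmetric matrix with all eigenvalues in `[-u, u]` obeys the scalar Bernstein estimate in
the Loewner order. -/
lemma posSemidef_quadratic_sub_exp {A : Matrix ι ι ℝ} {u : ℝ} (hu : u < 3)
    (h1 : (u • (1 : Matrix ι ι ℝ) - A).PosSemidef) (h2 : (u • (1 : Matrix ι ι ℝ) + A).PosSemidef)
    (hA : A.IsHermitian) :
    (1 + A + (2 * (1 - u / 3))⁻¹ • A ^ 2 - exp A).PosSemidef := by
  obtain ⟨U, d, hU, hU', rfl⟩ := exists_eq_conj_diagonal hA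
  have hconj (B : Matrix ι ι ℝ) : Uᴴ * (U * B * Uᴴ) * U = B := by
    simp only [mul_assoc, hU', mul_one]
    rw [← mul_assoc, hU', one_mul]
  have hscal (c : ℝ) : c • (1 : Matrix ι ι ℝ) = U * c • (1 : Matrix ι ι ℝ) * Uᴴ := by
    rw [Matrix.mul_smul, Matrix.smul_mul, mul_one, hU]
  have h1' := h1.conjTranspose_mul_mul_same U
  have h2' := h2.conjTranspose_mul_mul_same U
  rw [hscal, ← sub_mul, ← mul_sub, hconj, smul_one_eq_diagonal,
    diagonal_sub, posSemidef_diagonal_iff] at h1'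
  rw [hscal, ← add_mul, ← mul_add, hconj, smul_one_eq_diagonal,
    diagonal_add, posSemidef_diagonal_iff] at h2'
  have hsq : (U * diagonal d * Uᴴ) ^ 2 = U * diagonal (fun i => d i ^ 2) * Uᴴ := by
    have h : (U * diagonal d * Uᴴ) ^ 2 = U * (diagonal d * (Uᴴ * U) * diagonal d) * Uᴴ := by
      simp only [sq, mul_assoc]
    rw [h, hU', mul_one, diagonal_mul_diagonal]
    simp only [sq]
  rw [exp_conj_diagonal hU, hsq, ← one_smul ℝ (1 : Matrix ι ι ℝ), hscal, ← Matrix.smul_mul,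
    ← Matrix.mul_smul, ← add_mul, ← mul_add, ← add_mul,
    ← mul_add, ← sub_mul, ← mul_sub]
  refine PosSemidef.mul_mul_conjTranspose_same ?_ U
  rw [one_smul, ← diagonal_one, ← diagonal_smul, diagonal_add, diagonal_add, diagonal_sub]
  refine PosSemidef.diagonal fun i => ?_
  have := exp_le_one_add_add_sq (x := d i) (u := u)
    (abs_le.2 ⟨by linarith [h2' i], by linarith [h1' i]⟩) hu
  simpa using this

/-- The trace of the exponential detects every bound on the quadratic form: each eigenvalue `d`
satisfies `exp d ≤ tr (exp A)`. -/
lemma dotProduct_mulVec_le_of_trace_exp_le {A : Matrix ι ι ℝ} (hA : A.IsHermitian) {c : ℝ}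
    (h : (exp A).trace ≤ Real.exp c) (x : ι → ℝ) : x ⬝ᵥ A *ᵥ x ≤ c * (x ⬝ᵥ x) := by
  obtain ⟨U, d, hU, hU', rfl⟩ := exists_eq_conj_diagonal hA
  rw [exp_conj_diagonal hU, trace_mul_cycle, hU', one_mul, trace_diagonal] at h
  have hd (i : ι) : d i ≤ c := Real.exp_le_exp.1
    ((Finset.single_le_sum (f := fun i => Real.exp (d i)) (fun _ _ => (Real.exp_pos _).le)
      (Finset.mem_univ i)).trans h)
  have hP : (c • (1 : Matrix ι ι ℝ) - U * diagonal d * Uᴴ).PosSemidef := by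
    have e : c • (1 : Matrix ι ι ℝ) - U * diagonal d * Uᴴ =
        U * diagonal (fun i => c - d i) * Uᴴ := by
      rw [← diagonal_sub, ← smul_one_eq_diagonal, mul_sub, sub_mul, Matrix.mul_smul,
        Matrix.smul_mul, mul_one, hU]
    rw [e]
    exact (PosSemidef.diagonal fun i => sub_nonneg.2 (hd i)).mul_mul_conjTranspose_same U
  have := hP.dotProduct_mulVec_nonneg x
  simpa [sub_mulVec, smul_mulVec, dotProduct_sub] using this

variable {κ : Type*} [Fintype κ]

/-- One step of the Ahlswede–Winter induction: adding an independent centred increment multiplies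
the expected trace exponential by at most `exp v`, where `v` bounds its Bernstein-weighted
variance. -/
lemma sum_trace_exp_add_le {p : κ → ℝ} (hp : ∀ x, 0 ≤ p x) (hp1 : ∑ x, p x = 1)
    {Y : κ → Matrix ι ι ℝ} (hY : ∀ x, (Y x).IsHermitian) (hmean : ∑ x, p x • Y x = 0)
    {u v : ℝ} (hu : u < 3)
    (h1 : ∀ x, (u • (1 : Matrix ι ι ℝ) - Y x).PosSemidef)
    (h2 : ∀ x, (u • (1 : Matrix ι ι ℝ) + Y x).PosSemidef)
    (hvar : (v • (1 : Matrix ι ι ℝ) - (2 * (1 - u / 3))⁻¹ • ∑ x, p x • Y x ^ 2).PosSemidef)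
    {H : Matrix ι ι ℝ} (hH : H.IsHermitian) :
    ∑ x, p x * (exp (H + Y x)).trace ≤ Real.exp v * (exp H).trace := by
  have hE := posSemidef_exp hH
  have hle (x : κ) : p x * (exp (H + Y x)).trace ≤
      (exp H * (p x • (1 + Y x + (2 * (1 - u / 3))⁻¹ • Y x ^ 2))).trace := by
    rw [Matrix.mul_smul, trace_smul, smul_eq_mul]
    refine mul_le_mul_of_nonneg_left ((trace_exp_add_le hH (hY x)).trans ?_) (hp x)
    have := trace_mul_nonneg hE (posSemidef_quadratic_sub_exp hu (h1 x) (h2 x) (hY x))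
    rw [mul_sub, trace_sub] at this
    linarith
  refine (Finset.sum_le_sum fun x _ => hle x).trans ?_
  have hsum : ∑ x, p x • (1 + Y x + (2 * (1 - u / 3))⁻¹ • Y x ^ 2) =
      1 + (2 * (1 - u / 3))⁻¹ • ∑ x, p x • Y x ^ 2 := by
    simp only [smul_add, Finset.sum_add_distrib, ← Finset.sum_smul, hp1, hmean, one_smul, add_zero,
      Finset.smul_sum, smul_comm (2 * (1 - u / 3))⁻¹]
  rw [← trace_sum, ← Finset.mul_sum, hsum]
  have h3 := trace_mul_nonneg hE hvar
  rw [mul_sub, trace_sub, Matrix.mul_smul, mul_one, trace_smul, smul_eq_mul] at h3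
  rw [mul_add, mul_one, trace_add]
  nlinarith [Real.add_one_le_exp v, hE.trace_nonneg]

/-- The expected trace exponential of a sum of `s` independent copies of `Y`, started at `H`. The
expectation over the product law is written as a finite sum over all samples. -/
lemma sum_prod_mul_trace_exp_le {p : κ → ℝ} (hp : ∀ x, 0 ≤ p x) (hp1 : ∑ x, p x = 1)
    {Y : κ → Matrix ι ι ℝ} (hY : ∀ x, (Y x).IsHermitian) (hmean : ∑ x, p x • Y x = 0)
    {u v : ℝ} (hu : u < 3)
    (h1 : ∀ x, (u • (1 : Matrix ι ι ℝ) - Y x).PosSemidef)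
    (h2 : ∀ x, (u • (1 : Matrix ι ι ℝ) + Y x).PosSemidef)
    (hvar : (v • (1 : Matrix ι ι ℝ) - (2 * (1 - u / 3))⁻¹ • ∑ x, p x • Y x ^ 2).PosSemidef)
    (s : ℕ) {H : Matrix ι ι ℝ} (hH : H.IsHermitian) :
    ∑ a : Fin s → κ, (∏ t, p (a t)) * (exp (H + ∑ t, Y (a t))).trace ≤
      Real.exp v ^ s * (exp H).trace := by
  induction s generalizing H with
  | zero => simp
  | succ s ih =>
    rw [← (Fin.consEquiv fun _ => κ).sum_comp, Fintype.sum_prod_type]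
    simp only [Fin.consEquiv_apply, Fin.prod_univ_succ, Fin.sum_univ_succ, Fin.cons_zero,
      Fin.cons_succ, mul_assoc, ← Finset.mul_sum, ← add_assoc]
    calc ∑ x, p x * ∑ a : Fin s → κ, (∏ t, p (a t)) * (exp (H + Y x + ∑ t, Y (a t))).trace
        ≤ ∑ x, p x * (Real.exp v ^ s * (exp (H + Y x)).trace) :=
          Finset.sum_le_sum fun x _ => mul_le_mul_of_nonneg_left (ih (hH.add (hY x))) (hp x)
      _ = Real.exp v ^ s * ∑ x, p x * (exp (H + Y x)).trace := by
          rw [Finset.mul_sum]; exact Finset.sum_congr rfl fun x _ => by ring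
      _ ≤ Real.exp v ^ s * (Real.exp v * (exp H).trace) := by
          gcongr
          exact sum_trace_exp_add_le hp hp1 hY hmean hu h1 h2 hvar hH
      _ = Real.exp v ^ (s + 1) * (exp H).trace := by ring

/-- The **matrix Bernstein inequality** for `s` independent copies of a centred symmetric random
matrix `Z` with `-r ≤ Z ≤ r` and `E Z ^ 2 ≤ w`, as a bound on the trace exponential of
the sum at the standard parameter `θ = e / (w + r * e / 3)`. -/
lemma matrix_bernstein {p : κ → ℝ} (hp : ∀ x, 0 ≤ p x) (hp1 : ∑ x, p x = 1)
    {Z : κ → Matrix ι ι ℝ} (hZ : ∀ x, (Z x).IsHermitian) (hmean : ∑ x, p x • Z x = 0)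
    {r w e : ℝ} (hr : 0 ≤ r) (hw : 0 < w) (he : 0 < e)
    (h1 : ∀ x, (r • (1 : Matrix ι ι ℝ) - Z x).PosSemidef)
    (h2 : ∀ x, (r • (1 : Matrix ι ι ℝ) + Z x).PosSemidef)
    (hvar : (w • (1 : Matrix ι ι ℝ) - ∑ x, p x • Z x ^ 2).PosSemidef) (s : ℕ) :
    ∑ a : Fin s → κ, (∏ t, p (a t)) *
        (exp ((e / (w + r * e / 3)) • ∑ t, Z (a t))).trace ≤
      Fintype.card ι * Real.exp (s * (e * (e / (w + r * e / 3)) / 2)) := by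
  set θ := e / (w + r * e / 3) with hθ
  have hden : 0 < w + r * e / 3 := by positivity
  have hθ0 : 0 < θ := by positivity
  have hu' : 1 - θ * r / 3 = w / (w + r * e / 3) := by rw [hθ]; field_simp; ring
  have hu : θ * r < 3 := by
    have : 0 < 1 - θ * r / 3 := hu' ▸ by positivity
    linarith
  have hbern : (2 * (1 - θ * r / 3))⁻¹ * (θ ^ 2 * w) = e * θ / 2 := by
    rw [hu', hθ]; field_simp
  have h := sum_prod_mul_trace_exp_le (Y := fun x => θ • Z x) (u := θ * r) (v := e * θ / 2) hp hp1
    (fun x => (hZ x).smul (.all _))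
    (by simp only [smul_comm _ θ, ← Finset.smul_sum, hmean, smul_zero]) hu
    (fun x => by rw [mul_smul, ← smul_sub]; exact (h1 x).smul hθ0.le)
    (fun x => by rw [mul_smul, ← smul_add]; exact (h2 x).smul hθ0.le)
    (by
      have : 0 ≤ (2 * (1 - θ * r / 3))⁻¹ * θ ^ 2 := by rw [hu']; positivity
      have h3 := hvar.smul this
      rw [smul_sub, smul_smul, mul_assoc, hbern, mul_smul] at h3
      simpa only [smul_pow, smul_comm _ (θ ^ 2), ← Finset.smul_sum] using h3) s
    (isHermitian_zero (n := ι) (α := ℝ))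
  simp only [zero_add, ← Finset.smul_sum, exp_zero, trace_one, ← Real.exp_nat_mul] at h
  linarith

end Bernstein

/-! ### The symmetric dilation -/

section Dilation

/-- The symmetric dilation `[[0, A], [Aᵀ, 0]]` of a rectangular matrix, whose largest eigenvalue
is the spectral norm of `A`. -/
noncomputable def dilation {μ ν : Type*} : Matrix μ ν ℝ →ₗ[ℝ] Matrix (μ ⊕ ν) (μ ⊕ ν) ℝ where
  toFun A := fromBlocks 0 A Aᵀ 0
  map_add' A B := by simp [fromBlocks_add]
  map_smul' c A := by simp [fromBlocks_smul]

lemma dilation_apply {μ ν : Type*} (A : Matrix μ ν ℝ) :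
    dilation A = fromBlocks 0 A Aᵀ 0 := rfl

lemma isHermitian_dilation {μ ν : Type*} (A : Matrix μ ν ℝ) : (dilation A).IsHermitian := by
  simp [dilation_apply, IsHermitian, fromBlocks_transpose]

variable {μ ν : Type*} [Fintype μ] [Fintype ν]

lemma dotProduct_dilation_mulVec (A : Matrix μ ν ℝ) (x : μ → ℝ) (y : ν → ℝ) :
    Sum.elim x y ⬝ᵥ dilation A *ᵥ Sum.elim x y = 2 * (x ⬝ᵥ A *ᵥ y) := by
  simp only [dilation_apply, fromBlocks_mulVec, Sum.elim_comp_inl,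
    Sum.elim_comp_inr, zero_mulVec, zero_add, add_zero, sumElim_dotProduct_sumElim]
  rw [mulVec_transpose, dotProduct_comm y, ← dotProduct_mulVec, two_mul]

/-- Cauchy–Schwarz followed by the inequality of arithmetic and geometric means. -/
lemma two_mul_dotProduct_mulVec_le (A : Matrix μ ν ℝ) (x : μ → ℝ) (y : ν → ℝ) :
    2 * (x ⬝ᵥ A *ᵥ y) ≤ √(∑ i, ∑ j, A i j ^ 2) * (x ⬝ᵥ x + y ⬝ᵥ y) := by
  have hx : 0 ≤ x ⬝ᵥ x := by simpa using dotProduct_star_self_nonneg x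
  have hy : 0 ≤ y ⬝ᵥ y := by simpa using dotProduct_star_self_nonneg y
  have hA : 0 ≤ ∑ i, ∑ j, A i j ^ 2 := by positivity
  have h := Finset.sum_mul_sq_le_sq_mul_sq (Finset.univ : Finset (μ × ν))
    (fun q => A q.1 q.2) (fun q => x q.1 * y q.2)
  have e1 : ∑ q : μ × ν, A q.1 q.2 * (x q.1 * y q.2) = x ⬝ᵥ A *ᵥ y := by
    simp only [Fintype.sum_prod_type, dotProduct, mulVec, Finset.mul_sum]
    exact Finset.sum_congr rfl fun _ _ => Finset.sum_congr rfl fun _ _ => by ring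
  have e2 : ∑ q : μ × ν, (x q.1 * y q.2) ^ 2 = (x ⬝ᵥ x) * (y ⬝ᵥ y) := by
    simp only [Fintype.sum_prod_type, dotProduct, Finset.sum_mul_sum]
    exact Finset.sum_congr rfl fun _ _ => Finset.sum_congr rfl fun _ _ => by ring
  rw [e1, e2, Fintype.sum_prod_type] at h
  refine le_of_sq_le_sq ?_ (by positivity)
  rw [mul_pow, mul_pow, Real.sq_sqrt hA]
  nlinarith [mul_nonneg hA (sq_nonneg (x ⬝ᵥ x - y ⬝ᵥ y))]

variable [DecidableEq μ] [DecidableEq ν]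

lemma posSemidef_smul_one_sub_dilation {A : Matrix μ ν ℝ} {r : ℝ}
    (h : ∀ x y, 2 * (x ⬝ᵥ A *ᵥ y) ≤ r * (x ⬝ᵥ x + y ⬝ᵥ y)) :
    (r • (1 : Matrix (μ ⊕ ν) (μ ⊕ ν) ℝ) - dilation A).PosSemidef := by
  refine .of_dotProduct_mulVec_nonneg
    ((isHermitian_one.smul (.all r)).sub (isHermitian_dilation A)) fun z => ?_
  rw [star_trivial, ← Sum.elim_comp_inl_inr z, sub_mulVec, dotProduct_sub,
    dotProduct_dilation_mulVec, smul_mulVec, one_mulVec, dotProduct_smul,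
    sumElim_dotProduct_sumElim, smul_eq_mul]
  exact sub_nonneg.2 (h _ _)

lemma dilation_single_sq (i : μ) (j : ν) (c : ℝ) :
    dilation (single i j c) ^ 2 =
      diagonal (Sum.elim (Pi.single i (c ^ 2)) (Pi.single j (c ^ 2))) := by
  simp only [dilation_apply, sq, fromBlocks_multiply, transpose_single,
    single_mul_single_same, Matrix.zero_mul, Matrix.mul_zero, zero_add, add_zero]
  rw [← fromBlocks_diagonal, diagonal_single, diagonal_single]

end Dilation

lemma specNorm_le_of_dilation_le {m n : ℕ} {A : Matrix (Fin m) (Fin n) ℝ} {c : ℝ} (hc : 0 ≤ c)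
    (h : ∀ z, z ⬝ᵥ dilation A *ᵥ z ≤ c * (z ⬝ᵥ z)) : specNorm A ≤ c := by
  refine ContinuousLinearMap.opNorm_le_bound _ hc fun y => ?_
  set w := (toEuclideanLin A).toContinuousLinearMap y with hw
  have hnorm {k : ℕ} (v : EuclideanSpace ℝ (Fin k)) : v.ofLp ⬝ᵥ v.ofLp = ‖v‖ ^ 2 := by
    rw [EuclideanSpace.real_norm_sq_eq]; simp [dotProduct, sq]
  have hAy : A *ᵥ y.ofLp = w.ofLp := by simp [hw, toLpLin_apply]
  rcases (norm_nonneg w).eq_or_lt with hw0 | hw0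
  · rw [← hw0]; positivity
  have hy0 : 0 < ‖y‖ := norm_pos_iff.2 fun hy => by simp [hw, hy] at hw0
  -- The test vector is balanced: both of its blocks have norm `‖w‖ * ‖y‖`.
  have h1 := h (Sum.elim (‖y‖ • w.ofLp) (‖w‖ • y.ofLp))
  rw [dotProduct_dilation_mulVec, sumElim_dotProduct_sumElim, mulVec_smul, hAy] at h1
  simp only [smul_dotProduct, dotProduct_smul, smul_eq_mul] at h1
  rw [hnorm w, hnorm y] at h1
  have h2 : 0 < 2 * ‖w‖ ^ 2 * ‖y‖ := by positivity
  refine le_of_mul_le_mul_left ?_ h2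
  linarith

/-! ### Probabilities of samples -/

/-- A probability for independent variables with values in a finite set is at most the sum of the
point masses of the product law. -/
lemma measureReal_le_sum_prod {m n s : ℕ} {Ω : Type*} [MeasurableSpace Ω] {P : Measure Ω}
    [IsProbabilityMeasure P] {p : Fin m → Fin n → ℝ} {idx : Fin s → Ω → Fin m × Fin n}
    (h : IsIIDSample P p idx) (B : Finset (Fin s → Fin m × Fin n)) :
    P.real {ω | (fun t => idx t ω) ∈ B} ≤ ∑ a ∈ B, ∏ t, p (a t).1 (a t).2 := by
  have hset : {ω | (fun t => idx t ω) ∈ B} = ⋃ a ∈ B, ⋂ t, idx t ⁻¹' {a t} := by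
    ext ω
    simp only [Set.mem_ofPred_eq, Set.mem_iUnion, Set.mem_iInter, Set.mem_preimage,
      Set.mem_singleton_iff, exists_prop]
    exact ⟨fun hω => ⟨_, hω, fun _ => rfl⟩, fun ⟨a, ha, hωa⟩ => by rwa [funext hωa]⟩
  rw [hset]
  refine (measureReal_biUnion_finset_le _ _).trans (Finset.sum_le_sum fun a _ => ?_)
  rw [measureReal_def, h.indep.meas_iInter fun t => ⟨{a t}, measurableSet_singleton _, rfl⟩,
    ENNReal.toReal_prod]
  exact (Finset.prod_congr rfl fun t _ => h.law t (a t).1 (a t).2).le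

/-! ### The sampled matrices -/

section Sampling

variable {m n : ℕ} {X : Matrix (Fin m) (Fin n) ℝ} {p : Fin m → Fin n → ℝ}

/-- One summand of the sampling operator, without the factor `1 / s`. -/
noncomputable def sampleMatrix (p : Fin m → Fin n → ℝ) (X : Matrix (Fin m) (Fin n) ℝ)
    (q : Fin m × Fin n) : Matrix (Fin m) (Fin n) ℝ :=
  single q.1 q.2 (X q.1 q.2 / p q.1 q.2)

lemma samplingOperator_sub_eq {s : ℕ} (hs : 0 < s) (a : Fin s → Fin m × Fin n) :
    samplingOperator p a X - X = (s : ℝ)⁻¹ • ∑ t, (sampleMatrix p X (a t) - X) := by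
  have hs' : (s : ℝ) ≠ 0 := by positivity
  rw [Finset.sum_sub_distrib, smul_sub, Finset.sum_const, Finset.card_univ, Fintype.card_fin,
    ← Nat.cast_smul_eq_nsmul ℝ, inv_smul_smul₀ hs', samplingOperator, one_div]
  rfl

lemma frobNorm_sq (X : Matrix (Fin m) (Fin n) ℝ) : frobNorm X ^ 2 = ∑ i, ∑ j, X i j ^ 2 :=
  Real.sq_sqrt (by positivity)

lemma sum_abs_le_mul_frobNorm (X : Matrix (Fin m) (Fin n) ℝ) :
    ∑ i, ∑ j, |X i j| ≤ max (m : ℝ) n * frobNorm X := by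
  have hF : 0 ≤ frobNorm X := Real.sqrt_nonneg _
  refine le_of_sq_le_sq ?_ (by positivity)
  have h := sq_sum_le_card_mul_sum_sq (s := (Finset.univ : Finset (Fin m × Fin n)))
    (f := fun q => |X q.1 q.2|)
  simp only [Fintype.sum_prod_type, sq_abs, Finset.card_univ, Fintype.card_prod,
    Fintype.card_fin, ← frobNorm_sq] at h
  refine h.trans ?_
  rw [mul_pow, sq (max (m : ℝ) n)]
  push_cast
  gcongr
  · exact le_max_left _ _
  · exact le_max_right _ _

lemma two_mul_dotProduct_single_mulVec_le (i : Fin m) (j : Fin n) (c : ℝ) (x : Fin m → ℝ)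
    (y : Fin n → ℝ) : 2 * (x ⬝ᵥ single i j c *ᵥ y) ≤ |c| * (x ⬝ᵥ x + y ⬝ᵥ y) := by
  refine (two_mul_dotProduct_mulVec_le _ x y).trans_eq ?_
  congr 1
  rw [← Real.sqrt_sq_eq_abs]
  congr 1
  rw [Finset.sum_eq_single i (fun b _ hb => by simp [hb.symm]) (by simp),
    Finset.sum_eq_single j (fun b _ hb => by simp [hb.symm]) (by simp)]
  simp

/-- The entrywise lower bound on the sampling probabilities, split into its quadratic and its
absolute-value part. -/
lemma sq_le_and_abs_le {β : ℝ} (hβ : 0 < β) (hF : 0 < frobNorm X)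
    (hpX : ∀ i j, β / 2 * (X i j ^ 2 / frobNorm X ^ 2 + |X i j| / ∑ k, ∑ l, |X k l|) ≤ p i j)
    (i : Fin m) (j : Fin n) :
    X i j ^ 2 ≤ 2 * frobNorm X ^ 2 / β * p i j ∧
      |X i j| ≤ 2 * (max (m : ℝ) n * frobNorm X) / β * p i j := by
  have h := hpX i j
  have hS0 : 0 ≤ ∑ k, ∑ l, |X k l| := by positivity
  have hq : 0 ≤ X i j ^ 2 / frobNorm X ^ 2 := by positivity
  have ha : 0 ≤ |X i j| / ∑ k, ∑ l, |X k l| := by positivity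
  constructor
  · have h1 : β / 2 * (X i j ^ 2 / frobNorm X ^ 2) ≤ p i j := by nlinarith
    calc X i j ^ 2 = 2 * frobNorm X ^ 2 / β * (β / 2 * (X i j ^ 2 / frobNorm X ^ 2)) := by
          field_simp
      _ ≤ _ := by gcongr
  · have h1 : β / 2 * (|X i j| / ∑ k, ∑ l, |X k l|) ≤ p i j := by nlinarith
    have hp0 : 0 ≤ p i j := le_trans (by positivity) h1
    have hle : |X i j| ≤ ∑ k, ∑ l, |X k l| :=
      (Finset.single_le_sum (f := fun l => |X i l|) (fun _ _ => abs_nonneg _)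
        (Finset.mem_univ j)).trans
        (Finset.single_le_sum (f := fun k => ∑ l, |X k l|) (fun _ _ => by positivity)
          (Finset.mem_univ i))
    rcases hS0.eq_or_lt with hS | hS
    · rw [← hS] at hle
      exact hle.trans (by positivity)
    calc |X i j| = 2 * (∑ k, ∑ l, |X k l|) / β * (β / 2 * (|X i j| / ∑ k, ∑ l, |X k l|)) := by
          field_simp
      _ ≤ 2 * (∑ k, ∑ l, |X k l|) / β * p i j := by gcongr
      _ ≤ _ := by gcongr; exact sum_abs_le_mul_frobNorm X

lemma sum_smul_sampleMatrix (h0 : ∀ i j, p i j = 0 → X i j = 0) :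
    ∑ q : Fin m × Fin n, p q.1 q.2 • sampleMatrix p X q = X := by
  conv_rhs => rw [matrix_eq_sum_single X]
  rw [Fintype.sum_prod_type]
  refine Finset.sum_congr rfl fun i _ => Finset.sum_congr rfl fun j _ => ?_
  rw [sampleMatrix, smul_single, smul_eq_mul]
  by_cases hp0 : p i j = 0
  · simp [hp0, h0 i j hp0]
  · rw [mul_div_cancel₀ _ hp0]

lemma sum_smul_dilation_sampleMatrix_sq :
    ∑ q : Fin m × Fin n, p q.1 q.2 • dilation (sampleMatrix p X q) ^ 2 =
      diagonal (Sum.elim (fun i => ∑ j, X i j ^ 2 / p i j) (fun j => ∑ i, X i j ^ 2 / p i j)) := by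
  have he (i : Fin m) (j : Fin n) : p i j * (X i j / p i j) ^ 2 = X i j ^ 2 / p i j := by
    by_cases hp0 : p i j = 0
    · simp [hp0]
    · field_simp
  simp only [sampleMatrix, dilation_single_sq, ← diagonal_smul]
  refine (map_sum (diagonalAddMonoidHom (Fin m ⊕ Fin n) ℝ) _ _).symm.trans ?_
  refine congrArg diagonal ?_
  funext k
  rw [Finset.sum_apply, Fintype.sum_prod_type]
  rcases k with i | j
  · rw [Finset.sum_eq_single i (fun b _ hb => by simp [Pi.single_eq_of_ne' hb]) (by simp)]
    simp [he]
  · simp only [Sum.elim_inr, Pi.smul_apply, smul_eq_mul]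
    refine Finset.sum_congr rfl fun i _ => ?_
    rw [Finset.sum_eq_single j (fun b _ hb => by simp [Pi.single_eq_of_ne' hb]) (by simp)]
    simp [he]

/-- The variance bound: both the row sums and the column sums of `X i j ^ 2 / p i j` are at most
`max m n` times the largest entry, and centring only decreases the second moment. -/
lemma posSemidef_variance (hp : IsProbDist p) {c : ℝ} (hc : ∀ i j, X i j ^ 2 ≤ c * p i j)
    (hc0 : 0 ≤ c) :
    ((max (m : ℝ) n * c) • (1 : Matrix (Fin m ⊕ Fin n) (Fin m ⊕ Fin n) ℝ) -
      ∑ q : Fin m × Fin n, p q.1 q.2 • dilation (sampleMatrix p X q - X) ^ 2).PosSemidef := by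
  have h0 (i : Fin m) (j : Fin n) (h : p i j = 0) : X i j = 0 := by
    have := hc i j
    rw [h, mul_zero] at this
    exact pow_eq_zero_iff two_ne_zero |>.1 (le_antisymm this (sq_nonneg _))
  have hsum1 : ∑ q : Fin m × Fin n, p q.1 q.2 = 1 := by
    rw [Fintype.sum_prod_type]; exact hp.sum_eq_one
  have hmean : ∑ q : Fin m × Fin n, p q.1 q.2 • dilation (sampleMatrix p X q) = dilation X := by
    conv_rhs => rw [← sum_smul_sampleMatrix h0]
    simp
  have hcenter : ∑ q : Fin m × Fin n, p q.1 q.2 • dilation (sampleMatrix p X q - X) ^ 2 =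
      ∑ q : Fin m × Fin n, p q.1 q.2 • dilation (sampleMatrix p X q) ^ 2 -
        dilation X * (dilation X)ᴴ := by
    rw [(isHermitian_dilation X).eq]
    simp only [map_sub, sq, sub_mul, mul_sub, smul_sub, Finset.sum_sub_distrib]
    simp only [← Matrix.smul_mul, ← Finset.sum_mul, hmean]
    simp only [Matrix.smul_mul, ← Finset.sum_smul, hsum1, one_smul]
    have e : ∑ q : Fin m × Fin n, p q.1 q.2 • (dilation X * dilation (sampleMatrix p X q)) =
        dilation X * dilation X := by
      simp only [← Matrix.mul_smul, ← Finset.mul_sum, hmean]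
    simp only [e]
    abel
  have hentry (i : Fin m) (j : Fin n) : X i j ^ 2 / p i j ≤ c :=
    div_le_of_le_mul₀ (hp.nonneg i j) hc0 (hc i j)
  rw [hcenter, sum_smul_dilation_sampleMatrix_sq, ← sub_add, smul_one_eq_diagonal, diagonal_sub]
  refine (PosSemidef.diagonal fun k => sub_nonneg.2 ?_).add (posSemidef_self_mul_conjTranspose _)
  rcases k with i | j
  · refine (Finset.sum_le_sum fun j _ => hentry i j).trans ?_
    rw [Finset.sum_const, Finset.card_univ, Fintype.card_fin, nsmul_eq_mul]
    gcongr
    exact le_max_right _ _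
  · refine (Finset.sum_le_sum fun i _ => hentry i j).trans ?_
    rw [Finset.sum_const, Finset.card_univ, Fintype.card_fin, nsmul_eq_mul]
    gcongr
    exact le_max_left _ _

lemma posSemidef_range (hp : IsProbDist p) {c : ℝ} (hc0 : 0 ≤ c)
    (hc : ∀ i j, |X i j| ≤ c * p i j) (q : Fin m × Fin n) :
    ((c + frobNorm X) • (1 : Matrix (Fin m ⊕ Fin n) (Fin m ⊕ Fin n) ℝ) -
        dilation (sampleMatrix p X q - X)).PosSemidef ∧
      ((c + frobNorm X) • (1 : Matrix (Fin m ⊕ Fin n) (Fin m ⊕ Fin n) ℝ) +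
        dilation (sampleMatrix p X q - X)).PosSemidef := by
  have hle : |X q.1 q.2 / p q.1 q.2| ≤ c := by
    rw [abs_div, abs_of_nonneg (hp.nonneg _ _)]
    exact div_le_of_le_mul₀ (hp.nonneg _ _) hc0 (hc _ _)
  have hbound (σ : ℝ) (hσ : |σ| = 1) (x : Fin m → ℝ) (y : Fin n → ℝ) :
      2 * (x ⬝ᵥ (σ • (sampleMatrix p X q - X)) *ᵥ y) ≤
        (c + frobNorm X) * (x ⬝ᵥ x + y ⬝ᵥ y) := by
    have hx : 0 ≤ x ⬝ᵥ x := by simpa using dotProduct_star_self_nonneg x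
    have hy : 0 ≤ y ⬝ᵥ y := by simpa using dotProduct_star_self_nonneg y
    have h1 := two_mul_dotProduct_single_mulVec_le q.1 q.2 (σ * (X q.1 q.2 / p q.1 q.2)) x y
    have h2 := two_mul_dotProduct_mulVec_le (-(σ • X)) x y
    have hσ2 : σ ^ 2 = 1 := by rw [← sq_abs, hσ, one_pow]
    rw [abs_mul, hσ, one_mul] at h1
    simp only [Matrix.neg_apply, Matrix.smul_apply, smul_eq_mul, neg_sq, mul_pow, hσ2, one_mul] at h2
    have h3 : σ • (sampleMatrix p X q - X) =
        single q.1 q.2 (σ * (X q.1 q.2 / p q.1 q.2)) + -(σ • X) := by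
      rw [smul_sub, sampleMatrix, smul_single, smul_eq_mul, sub_eq_add_neg]
    rw [h3, add_mulVec, dotProduct_add, frobNorm]
    nlinarith [mul_le_mul_of_nonneg_right hle (add_nonneg hx hy)]
  refine ⟨posSemidef_smul_one_sub_dilation fun x y => ?_, ?_⟩
  · simpa using hbound 1 (by simp) x y
  · have := posSemidef_smul_one_sub_dilation (hbound (-1) (by simp))
    simpa [sub_eq_add_neg, add_comm] using this

/-- The tail bound, with the mass of the bad samples written as a finite sum. The parameters are
a variance proxy `2 * N * F ^ 2 / β` and a range `3 * N * F / β`, where `N = max m n` and `F` is the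
Frobenius norm. -/
lemma sum_prod_bad_le {s : ℕ} {β ε : ℝ} (hs : 0 < s) (hε : 0 < ε) (hβ : 0 < β) (hβ1 : β ≤ 1)
    (hp : IsProbDist p) (hF : 0 < frobNorm X)
    (hpX : ∀ i j, β / 2 * (X i j ^ 2 / frobNorm X ^ 2 + |X i j| / ∑ k, ∑ l, |X k l|) ≤ p i j) :
    ∑ a : Fin s → Fin m × Fin n with ε < specNorm (samplingOperator p a X - X),
        ∏ t, p (a t).1 (a t).2 ≤
      (m + n) * Real.exp (-(s * ε ^ 2 * β /
        (2 * (max (m : ℝ) n * frobNorm X * (2 * frobNorm X + ε))))) := by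
  set F := frobNorm X
  set N := max (m : ℝ) n
  have hs' : (0 : ℝ) < s := by exact_mod_cast hs
  have hN : 1 ≤ N := by
    have hm : m ≠ 0 := by
      rintro rfl
      exact zero_ne_one (α := ℝ) (by simpa using hp.sum_eq_one)
    exact le_max_of_le_left (by exact_mod_cast Nat.one_le_iff_ne_zero.2 hm)
  have hN0 : 0 < N := by linarith
  have hsq (i : Fin m) (j : Fin n) := (sq_le_and_abs_le hβ hF hpX i j).1
  have habs (i : Fin m) (j : Fin n) := (sq_le_and_abs_le hβ hF hpX i j).2
  have h0 (i : Fin m) (j : Fin n) (h : p i j = 0) : X i j = 0 := by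
    have := habs i j
    rwa [h, mul_zero, abs_nonpos_iff] at this
  have hsum1 : ∑ q : Fin m × Fin n, p q.1 q.2 = 1 := by
    rw [Fintype.sum_prod_type]; exact hp.sum_eq_one
  -- The range `2 * N * F / β + F` is relaxed to `3 * N * F / β`, using `β ≤ 1 ≤ N`.
  have hrange : 2 * (N * F) / β + F ≤ 3 * (N * F) / β := by
    rw [div_add' _ _ _ hβ.ne']
    gcongr
    nlinarith
  have hrelax := (PosSemidef.one (R := ℝ) (n := Fin m ⊕ Fin n)).smul (sub_nonneg.2 hrange)
  have hpsd (q : Fin m × Fin n) := posSemidef_range hp (by positivity) habs q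
  have hbern := matrix_bernstein (p := fun q : Fin m × Fin n => p q.1 q.2)
    (Z := fun q => dilation (sampleMatrix p X q - X)) (r := 3 * (N * F) / β)
    (w := N * (2 * F ^ 2 / β)) (e := ε) (fun q => hp.nonneg _ _) hsum1
    (fun q => isHermitian_dilation _)
    (by
      simp only [← map_smul, ← map_sum]
      simp only [smul_sub, Finset.sum_sub_distrib, sum_smul_sampleMatrix h0, ← Finset.sum_smul,
        hsum1, one_smul, sub_self, map_zero])
    (by positivity) (by positivity) hε
    (fun q => by
      convert (hpsd q).1.add hrelax using 1
      rw [sub_smul]; abel)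
    (fun q => by
      convert (hpsd q).2.add hrelax using 1
      rw [sub_smul]; abel)
    (posSemidef_variance hp hsq (by positivity)) s
  set θ := ε / (N * (2 * F ^ 2 / β) + 3 * (N * F) / β * ε / 3) with hθ
  have hθ0 : 0 < θ := by positivity
  have hexp : s * ε ^ 2 * β / (2 * (N * F * (2 * F + ε))) = s * (ε * θ) / 2 := by
    rw [hθ]; field_simp
  have hmarkov (a : Fin s → Fin m × Fin n) (ha : ε < specNorm (samplingOperator p a X - X)) :
      Real.exp (s * (ε * θ)) ≤
        (exp (θ • ∑ t, dilation (sampleMatrix p X (a t) - X))).trace := by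
    by_contra! hlt
    refine absurd (specNorm_le_of_dilation_le hε.le fun z => ?_) (not_le.2 ha)
    rw [← map_sum] at hlt
    have h1 := dotProduct_mulVec_le_of_trace_exp_le
      ((isHermitian_dilation _).smul (.all θ)) hlt.le z
    rw [samplingOperator_sub_eq hs, map_smul, smul_mulVec, dotProduct_smul, smul_eq_mul,
      inv_mul_le_iff₀ hs']
    rw [smul_mulVec, dotProduct_smul, smul_eq_mul] at h1
    refine le_of_mul_le_mul_left ?_ hθ0
    linarith
  have hprod (a : Fin s → Fin m × Fin n) : 0 ≤ ∏ t, p (a t).1 (a t).2 :=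
    Finset.prod_nonneg fun t _ => hp.nonneg _ _
  have htr (a : Fin s → Fin m × Fin n) :
      0 ≤ (exp (θ • ∑ t, dilation (sampleMatrix p X (a t) - X))).trace := by
    rw [← map_sum]
    exact (posSemidef_exp ((isHermitian_dilation _).smul (.all θ))).trace_nonneg
  -- Markov's inequality for the trace exponential.
  have hcheb : (∑ a : Fin s → Fin m × Fin n with ε < specNorm (samplingOperator p a X - X),
      ∏ t, p (a t).1 (a t).2) * Real.exp (s * (ε * θ)) ≤
      (m + n) * Real.exp (s * (ε * θ / 2)) := by
    rw [Finset.sum_mul]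
    refine (Finset.sum_le_sum fun a ha => mul_le_mul_of_nonneg_left
      (hmarkov a (Finset.mem_filter.1 ha).2) (hprod a)).trans ?_
    refine (Finset.sum_le_sum_of_subset_of_nonneg (Finset.filter_subset _ _)
      fun a _ _ => mul_nonneg (hprod a) (htr a)).trans ?_
    simpa using hbern
  rw [← le_div_iff₀ (Real.exp_pos _), mul_div_assoc, ← Real.exp_sub] at hcheb
  refine hcheb.trans_eq ?_
  rw [hexp]
  congr 2
  ring

end Sampling

theorem theorem1 {m n s : ℕ} {Ω : Type*} [MeasurableSpace Ω] (P : Measure Ω)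
    [IsProbabilityMeasure P] (X : Matrix (Fin m) (Fin n) ℝ) (p : Fin m → Fin n → ℝ)
    (idx : Fin s → Ω → Fin m × Fin n) (β ε δ : ℝ)
    (hs : 0 < s) (hε : 0 < ε) (hδ : 0 < δ) (hβ : 0 < β) (hβ1 : β ≤ 1)
    (hp : IsProbDist p)
    (hpX : ∀ i j, β / 2 * (X i j ^ 2 / frobNorm X ^ 2 + |X i j| / ∑ k, ∑ l, |X k l|) ≤ p i j)
    (hidx : IsIIDSample P p idx)
    (hcase :
      (ε ≤ frobNorm X ∧
        6 * max (m : ℝ) (n : ℝ) * Real.log (((m : ℝ) + (n : ℝ)) / δ) / (β * ε ^ 2) *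
          frobNorm X ^ 2 ≤ (s : ℝ)) ∨
      (frobNorm X < ε ∧
        6 * max (m : ℝ) (n : ℝ) * Real.log (((m : ℝ) + (n : ℝ)) / δ) / (β * ε) *
          frobNorm X ≤ (s : ℝ))) :
    1 - δ ≤ P.real {ω | specNorm (samplingOperator p (fun t => idx t ω) X - X) ≤ ε} := by
  have hF0 : 0 ≤ frobNorm X := Real.sqrt_nonneg _
  rcases hF0.eq_or_lt with hF | hF
  -- For `X = 0` the sampling operator is exact, whatever `p` is.
  · have hX : X = 0 := by
      have h := frobNorm_sq X
      rw [← hF, zero_pow two_ne_zero] at h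
      ext i j
      have h1 := (Finset.sum_eq_zero_iff_of_nonneg fun i _ => by positivity).1 h.symm i
        (Finset.mem_univ i)
      exact pow_eq_zero_iff two_ne_zero |>.1 ((Finset.sum_eq_zero_iff_of_nonneg
        fun j _ => by positivity).1 h1 j (Finset.mem_univ j))
    have huniv : {ω | specNorm (samplingOperator p (fun t => idx t ω) X - X) ≤ ε} = Set.univ := by
      refine Set.eq_univ_of_forall fun ω => ?_
      simp [hX, samplingOperator, specNorm, hε.le]
    rw [huniv, probReal_univ]
    linarith
  set F := frobNorm X
  set N := max (m : ℝ) n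
  have hm : (0 : ℝ) < m := by
    refine Nat.cast_pos.2 (Nat.pos_of_ne_zero ?_)
    rintro rfl
    exact zero_ne_one (α := ℝ) (by simpa using hp.sum_eq_one)
  have hN : 0 < N := lt_max_of_lt_left hm
  have hs' : (0 : ℝ) < s := by exact_mod_cast hs
  have hlog : Real.log (((m : ℝ) + n) / δ) ≤ s * ε ^ 2 * β / (2 * (N * F * (2 * F + ε))) := by
    rcases hcase with ⟨hle, hsle⟩ | ⟨hlt, hsle⟩
    · rw [div_mul_eq_mul_div, div_le_iff₀ (by positivity)] at hsle
      calc Real.log (((m : ℝ) + n) / δ)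
          = 6 * N * Real.log (((m : ℝ) + n) / δ) * F ^ 2 / (2 * (N * F * (2 * F + F))) := by
            field_simp; ring
        _ ≤ s * (β * ε ^ 2) / (2 * (N * F * (2 * F + F))) := by gcongr
        _ ≤ s * (β * ε ^ 2) / (2 * (N * F * (2 * F + ε))) := by gcongr
        _ = _ := by ring
    · rw [div_mul_eq_mul_div, div_le_iff₀ (by positivity)] at hsle
      calc Real.log (((m : ℝ) + n) / δ)
          = 6 * N * Real.log (((m : ℝ) + n) / δ) * F * ε / (2 * (N * F * (2 * ε + ε))) := by
            field_simp; ring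
        _ ≤ s * (β * ε) * ε / (2 * (N * F * (2 * ε + ε))) := by gcongr
        _ ≤ s * (β * ε) * ε / (2 * (N * F * (2 * F + ε))) := by gcongr
        _ = _ := by ring
  have hbad : P.real {ω | ε < specNorm (samplingOperator p (fun t => idx t ω) X - X)} ≤ δ := by
    have h1 := measureReal_le_sum_prod hidx
      {a | ε < specNorm (samplingOperator p a X - X)}
    simp only [Finset.mem_filter, Finset.mem_univ, true_and] at h1
    refine h1.trans ((sum_prod_bad_le hs hε hβ hβ1 hp hF hpX).trans ?_)
    have hmn : (0 : ℝ) < m + n := by positivity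
    calc ((m : ℝ) + n) * Real.exp (-(s * ε ^ 2 * β / (2 * (N * F * (2 * F + ε)))))
        ≤ (m + n) * Real.exp (-Real.log (((m : ℝ) + n) / δ)) := by gcongr
      _ = δ := by rw [Real.exp_neg, Real.exp_log (by positivity)]; field_simp
  have hunion := measureReal_union_le (μ := P)
    {ω | specNorm (samplingOperator p (fun t => idx t ω) X - X) ≤ ε}
    {ω | ε < specNorm (samplingOperator p (fun t => idx t ω) X - X)}
  have huniv : {ω | specNorm (samplingOperator p (fun t => idx t ω) X - X) ≤ ε} ∪
      {ω | ε < specNorm (samplingOperator p (fun t => idx t ω) X - X)} = Set.univ :=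
    Set.eq_univ_of_forall fun ω => le_or_gt (specNorm (samplingOperator p (fun t => idx t ω) X - X)) ε
  rw [huniv, probReal_univ] at hunion
  linarith
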